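/- A degree sequence of length $n$ is a sequence $d=(d_1,\dots,d_n)$ of positive integers $d_i\le n-1$ with even sum; it is graphic if there is a simple graph on $\{v_1,\dots,v_n\}$ in which $v_i$ has degree $d_i$ for every $i$. For positive integers $n>c_1\ge c_2$ and an integer $\Sigma$, let $\mathbb{D}(n,\Sigma,c_1,c_2)$ be the set of all degree sequences $d$ of length $n$ with $\sum_i d_i=\Sigma$ and $c_2\le d_i\le c_1$ for all $i$; call it fully graphic if each of its members is graphic. For $1\le p,q\le n$ let $D+1_{+q}^{+p}$ be the sequence obtained from $D$ by adding $1$ to its $p$-th and $1$ to its $q$-th term (so $2$ is added to the $p$-th term if $p=q$). An edge-abundant trail in a simple graph $G$ between vertices $v$ and $v'$ (not necessarily distinct) is a sequence of vertices $v=x_0,x_1,\dots,x_\ell=v'$ with $\ell$ odd and $x_{i}\neq x_{i+1}$, such that the pairs $\{x_i,x_{i+1}\}$, $0\le i<\ell$, are pairwise distinct, and are alternately edges and non-edges of $G$, starting with an edge; $\ell$ is its length. **Theorem 2.3.** Suppose that $\mathbb{D}(n,\Sigma,c_1,c_2)$ is fully graphic, $D\in\mathbb{D}(n,\Sigma,c_1,c_2)$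 and $1\le p,q\le n$ (possibly $p=q$). Let $G$ be a simple graph on $\{v_1,\dots,v_n\}$ with degree sequence $D+1_{+q}^{+p}$ in which $v_p$ and $v_q$ have the same set of neighbours, $\Gamma_G(v_p)=\Gamma_G(v_q)$. Then there is an edge-abundant trail of length at most $11$ between $v_p$ and $v_q$ in $G$. -/

import Mathlib

namespace DegSeq

/-- A degree sequence of length `n`: positive integers, none exceeding `n - 1`, with even sum. -/
def IsDegreeSequence {n : ℕ} (d : Fin n → ℕ) : Prop :=
  (∀ i, 0 < d i ∧ d i < n) ∧ Even (∑ i, d i)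

open scoped Classical in
/-- The simple graph `G` on the vertices `v_i` (`i : Fin n`) has degree sequence `d`. -/
def Realizes {n : ℕ} (G : SimpleGraph (Fin n)) (d : Fin n → ℕ) : Prop :=
  ∀ i, G.degree i = d i

/-- A sequence is graphic if it has a realization by a simple graph. -/
def IsGraphic {n : ℕ} (d : Fin n → ℕ) : Prop :=
  ∃ G : SimpleGraph (Fin n), Realizes G d

/-- The simple region `𝔻(n, Σ, a, b)`: the degree sequences of length `n` with sum `Σ` and all
of whose terms lie between `b` and `a`. -/
def simpleRegion (n S a b : ℕ) : Set (Fin n → ℕ) :=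
  {d | IsDegreeSequence d ∧ (∀ i, b ≤ d i ∧ d i ≤ a) ∧ ∑ i, d i = S}

/-- A region is fully graphic if each of its members is graphic. -/
def FullyGraphic {n : ℕ} (𝔻 : Set (Fin n → ℕ)) : Prop :=
  ∀ d ∈ 𝔻, IsGraphic d

/-- The perturbed sequence `D + 1^{+p}_{+q}`; if `p = q`, then `2` is added at `p`. -/
def perturb {n : ℕ} (D : Fin n → ℕ) (p q : Fin n) : Fin n → ℕ :=
  D + Pi.single p 1 + Pi.single q 1

variable {V : Type*}

/-- A walk in the complete graph on the vertex set of `G` is a sequence of vertices in which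
consecutive ones are distinct, so each step is an edge or a non-edge of `G`. It alternates if, of
any two consecutive steps, exactly one is an edge of `G`. -/
def IsAlternating (G : SimpleGraph V) {u v : V} (w : (⊤ : SimpleGraph V).Walk u v) : Prop :=
  ∀ i, i + 1 < w.length →
    (G.Adj (w.getVert i) (w.getVert (i + 1)) ↔ ¬ G.Adj (w.getVert (i + 1)) (w.getVert (i + 2)))

/-- An edge-abundant trail: an alternating trail of edges and non-edges of `G` (no pair of
vertices is used twice, vertices may repeat) of odd length whose first element is an edge. -/
structure IsEdgeAbundant (G : SimpleGraph V) {u v : V} (w : (⊤ : SimpleGraph V).Walk u v) :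
    Prop where
  isTrail : w.IsTrail
  alternating : IsAlternating G w
  odd_length : Odd w.length
  first_edge : G.Adj (w.getVert 0) (w.getVert 1)

/-- A `k`-witness trail: an edge-abundant trail of length at most `k`. -/
def IsWitnessTrail (G : SimpleGraph V) (k : ℕ) {u v : V} (w : (⊤ : SimpleGraph V).Walk u v) :
    Prop :=
  IsEdgeAbundant G w ∧ w.length ≤ k

end DegSeq

/-!
Suppose that no such trail joins `p` and `q`. Excluding a few explicit alternating sequences forces
an almost split structure on `G`: a clique `Y` and an independent set `Z` containing `p` and `q`
such that the remaining vertices are adjacent to all of `Y`, and such that the edges at `Z` end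
almost exclusively in `Y`. Hence `Y` and `Z` turn an inequality of Erdős and Gallai for the degrees
of `G` almost into an equality. The two units added at `p` and `q` enter the larger side of this
inequality, so it fails for a member of the region that is as large as possible on `Y` and as small
as possible on `Z`.
-/

namespace DegSeq

section Trails

variable {V : Type*} {G : SimpleGraph V} {q : V}

/-- The sequence from `u` to `q` whose non-edges are, in this order, the pairs of `l` alternates
between edges and non-edges of `G`, and its first and last pair are edges. An alternating trail is
encoded by its non-edges, as these determine its edges. -/
def AlternatesVia (G : SimpleGraph V) (q : V) : V → List (V × V) → Prop
  | u, [] => G.Adj u q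
  | u, (a, b) :: l => G.Adj u a ∧ Gᶜ.Adj a b ∧ AlternatesVia G q b l

/-- The edges of the alternating sequence from `u` to `q` whose non-edges are the pairs of `l`. -/
def linkingEdges (q : V) : V → List (V × V) → List (Sym2 V)
  | u, [] => [s(u, q)]
  | u, (a, b) :: l => s(u, a) :: linkingEdges q b l

namespace AlternatesVia

theorem mem_edgeSet : ∀ {u : V} {l : List (V × V)}, AlternatesVia G q u l →
    ∀ e ∈ linkingEdges q u l, e ∈ G.edgeSet
  | _, [], h, _, he => by
    rw [linkingEdges, List.mem_singleton] at he
    exact he ▸ h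
  | _, (_, _) :: _, ⟨hua, _, hl⟩, e, he => by
    rcases List.mem_cons.1 he with rfl | he
    · exact hua
    · exact hl.mem_edgeSet e he

theorem notMem_edgeSet : ∀ {u : V} {l : List (V × V)}, AlternatesVia G q u l →
    ∀ e ∈ l.map fun e => s(e.1, e.2), e ∉ G.edgeSet
  | _, (_, _) :: _, ⟨_, hab, hl⟩, e, he => by
    rcases List.mem_cons.1 he with rfl | he
    · exact hab.2
    · exact hl.notMem_edgeSet e he

theorem exists_walk : ∀ {u : V} {l : List (V × V)}, AlternatesVia G q u l →
    ∃ w : (⊤ : SimpleGraph V).Walk u q, w.length = 2 * l.length + 1 ∧ IsAlternating G w ∧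
      G.Adj (w.getVert 0) (w.getVert 1) ∧
      w.edges.Perm (linkingEdges q u l ++ l.map fun e => s(e.1, e.2))
  | _, [], h =>
    ⟨.cons h.ne .nil, rfl, fun i hi => by simp at hi, h,
      by simp [linkingEdges]⟩
  | u, (a, b) :: l, ⟨hua, hab, hl⟩ => by
    obtain ⟨w, hlen, halt, hfirst, hedges⟩ := hl.exists_walk
    refine ⟨.cons (v := a) hua.ne (.cons hab.ne w), by simp [hlen]; ring, fun i hi => ?_,
      by simpa using hua, ?_⟩
    · match i with
      | 0 => simpa using iff_of_true hua hab.2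
      | 1 => simpa using iff_of_false hab.2 (not_not_intro hfirst)
      | i + 2 => simpa using halt i (by simp at hi; omega)
    · exact ((hedges.cons _).trans List.perm_middle.symm).cons _

theorem exists_isWitnessTrail {p : V} {l : List (V × V)} (h : AlternatesVia G q p l)
    (hedges : (linkingEdges q p l).Nodup) (hnonedges : (l.map fun e => s(e.1, e.2)).Nodup) :
    ∃ w : (⊤ : SimpleGraph V).Walk p q, IsWitnessTrail G (2 * l.length + 1) w := by
  obtain ⟨w, hlen, halt, hfirst, hperm⟩ := h.exists_walk
  have hdisj : (linkingEdges q p l).Disjoint (l.map fun e => s(e.1, e.2)) := fun e he =>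
    mt (h.notMem_edgeSet e) (not_not_intro (h.mem_edgeSet e he))
  exact ⟨w, ⟨⟨hperm.nodup_iff.2 (hedges.append hnonedges hdisj)⟩, halt, ⟨_, hlen⟩, hfirst⟩,
    hlen.le⟩

end AlternatesVia

end Trails

theorem subsingleton_sdiff_sdiff_singleton {α : Type*} (s : Set α) (a : α) :
    (s \ (s \ {a})).Subsingleton :=
  Set.subsingleton_singleton.anti (Set.sdiff_sdiff_right_self s {a} ▸ Set.inter_subset_right)

section Exclusion

variable {V : Type*} {G : SimpleGraph V} {p q : V}

/-- The negation of the theorem: `p` and `q` have the same neighbours, and no edge-abundant trail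
of length at most `11` joins them. -/
structure UnlinkedTwins (G : SimpleGraph V) (p q : V) : Prop where
  neighborSet_eq : G.neighborSet p = G.neighborSet q
  not_isWitnessTrail : ∀ w : (⊤ : SimpleGraph V).Walk p q, ¬ IsWitnessTrail G 11 w

/-- The neighbour `a` of `p` is not adjacent to `x`. -/
def Misses (G : SimpleGraph V) (p a x : V) : Prop :=
  G.Adj p a ∧ Gᶜ.Adj a x

/-- `y` is one of the vertices, other than `p`, `q` and their neighbours, that are adjacent to
all neighbours of `p`. -/
structure IsOuter (G : SimpleGraph V) (p q y : V) : Prop where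
  ne_left : y ≠ p
  ne_right : y ≠ q
  not_adj : ¬ G.Adj p y
  adj : ∀ ⦃a⦄, G.Adj p a → G.Adj a y

/-- `p, a, x, y` is an alternating path that ends in an outer vertex: each long trail is composed
of two such paths, one read backwards, and of pairs joining their ends. -/
structure IsStem (G : SimpleGraph V) (p q a x y : V) : Prop where
  misses : Misses G p a x
  adj : G.Adj x y
  isOuter : IsOuter G p q y

/-- `y` and `y'` are joined by a non-edge, or through two outer vertices by a non-edge, an edge
and a non-edge. In both cases two stems with the ends `y` and `y'` are joined to an alternating
sequence from `p` to `q`. The case `y = y'` is included. -/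
def Coupled (G : SimpleGraph V) (p q y y' : V) : Prop :=
  Gᶜ.Adj y y' ∨
    ∃ z z', IsOuter G p q z ∧ IsOuter G p q z' ∧ Gᶜ.Adj y z ∧ G.Adj z z' ∧ Gᶜ.Adj z' y'

/-- The alternating sequence `p, a, x₁, x₂, a` that returns to `a`. -/
structure IsBlossom (G : SimpleGraph V) (p a x₁ x₂ : V) : Prop where
  misses_left : Misses G p a x₁
  misses_right : Misses G p a x₂
  adj : G.Adj x₁ x₂

/-- `y` is coupled with the end of some stem. Along such outer vertices the stems are rigid, while
the other ends of stems can be added to the neighbours of `p`. -/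
def IsBound (G : SimpleGraph V) (p q y : V) : Prop :=
  ∃ a x y', IsStem G p q a x y' ∧ Coupled G p q y y'

theorem Coupled.symm {y y' : V} : Coupled G p q y y' → Coupled G p q y' y
  | .inl h => .inl h.symm
  | .inr ⟨z, z', hz, hz', hyz, hzz', hzy'⟩ =>
    .inr ⟨z', z, hz', hz, hzy'.symm, hzz'.symm, hyz.symm⟩

theorem isOuter_of_not_misses {v : V} (hp : v ≠ p) (hq : v ≠ q) (hv : ¬ G.Adj p v)
    (hmiss : ∀ a, ¬ Misses G p a v) : IsOuter G p q v :=
  ⟨hp, hq, hv, fun a ha => by_contra fun hav => hmiss a ⟨ha, fun he => hv (he ▸ ha), hav⟩⟩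

namespace UnlinkedTwins

variable {a a₁ a₂ b c u v x x' x₁ x₂ y y' y₁ y₂ z z' z₂ : V}

theorem adj_iff (h : UnlinkedTwins G p q) (v : V) : G.Adj p v ↔ G.Adj q v :=
  Set.ext_iff.1 h.neighborSet_eq v

theorem false_of_alternatesVia (h : UnlinkedTwins G p q) (l : List (V × V)) (hl : l.length ≤ 5)
    (halt : AlternatesVia G q p l ∧ (linkingEdges q p l).Nodup ∧
      (l.map fun e => s(e.1, e.2)).Nodup) : False := by
  obtain ⟨w, hw, hlen⟩ := halt.1.exists_isWitnessTrail halt.2.1 halt.2.2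
  exact h.not_isWitnessTrail w ⟨hw, by omega⟩

theorem isClique_neighborSet (h : UnlinkedTwins G p q) : G.IsClique (G.neighborSet p) := by
  intro a ha b hb hab
  by_contra hn
  rw [SimpleGraph.mem_neighborSet] at ha hb
  refine h.false_of_alternatesVia [(a, b)] (by simp) ?_
  simp only [AlternatesVia, linkingEdges, List.map_cons, List.map_nil, List.nodup_cons,
    List.mem_cons, List.not_mem_nil, Sym2.eq_iff, SimpleGraph.compl_adj]
  grind [SimpleGraph.adj_comm, SimpleGraph.irrefl, h.adj_iff]

theorem ne_and_not_adj_of_misses (h : UnlinkedTwins G p q) (hx : Misses G p a x) :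
    x ≠ p ∧ x ≠ q ∧ ¬ G.Adj p x := by
  refine ⟨?_, ?_, fun hpx => hx.2.2 (h.isClique_neighborSet hx.1 hpx hx.2.1)⟩
  · rintro rfl; exact hx.2.2 hx.1.symm
  · rintro rfl; exact hx.2.2 ((h.adj_iff a).1 hx.1).symm

theorem eq_of_misses (h : UnlinkedTwins G p q) (hx : Misses G p a x) (hx' : Misses G p b x')
    (hxx' : G.Adj x x') : a = b ∧ p = q := by
  by_contra hab
  refine h.false_of_alternatesVia [(a, x), (x', b)] (by simp) ?_
  simp only [AlternatesVia, linkingEdges, List.map_cons, List.map_nil, List.nodup_cons,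
    List.mem_cons, List.not_mem_nil, Sym2.eq_iff]
  grind (splits := 40) [SimpleGraph.adj_comm, SimpleGraph.irrefl, SimpleGraph.compl_adj,
    h.adj_iff, Misses]

theorem eq_of_coupled (h : UnlinkedTwins G p q) (s : IsStem G p q a x y)
    (s' : IsStem G p q b x' y') (hyy' : Coupled G p q y y') (hne : x ≠ x' ∨ y ≠ y') : a = b := by
  by_contra hab
  have hx' := h.ne_and_not_adj_of_misses s'.misses
  rcases hyy' with hyy' | ⟨z, z', hz, hz', hyz, hzz', hzy'⟩
  · refine h.false_of_alternatesVia [(a, x), (y, y'), (x', b)] (by simp) ?_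
    simp only [AlternatesVia, linkingEdges, List.map_cons, List.map_nil, List.nodup_cons,
      List.mem_cons, List.not_mem_nil, Sym2.eq_iff]
    grind (splits := 40) [SimpleGraph.adj_comm, SimpleGraph.irrefl, SimpleGraph.compl_adj,
      h.adj_iff, IsStem, Misses, IsOuter]
  · refine h.false_of_alternatesVia [(a, x), (y, z), (z', y'), (x', b)] (by simp) ?_
    simp only [AlternatesVia, linkingEdges, List.map_cons, List.map_nil, List.nodup_cons,
      List.mem_cons, List.not_mem_nil, Sym2.eq_iff]
    grind (splits := 40) [SimpleGraph.adj_comm, SimpleGraph.irrefl, SimpleGraph.compl_adj,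
      h.adj_iff, IsStem, Misses, IsOuter]

theorem adj_of_coupled (h : UnlinkedTwins G p q) (s₁ : IsStem G p q a x₁ y₁)
    (s₂ : IsStem G p q a x₂ y₂) (hy : Coupled G p q y₁ y₂) (hne : y₁ ≠ y₂)
    (s : IsStem G p q c x y) (hac : a ≠ c) : G.Adj x₂ y := by
  by_contra hn
  have hx := h.ne_and_not_adj_of_misses s.misses
  have hy₁ : y ≠ y₁ := by
    rintro rfl
    exact hac (h.eq_of_coupled s s₂ hy (.inr hne)).symm
  have hy₂ : y ≠ y₂ := by
    rintro rfl
    exact hac (h.eq_of_coupled s₁ s hy (.inr hne))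
  have hxx₂ : x ≠ x₂ := by
    rintro rfl
    exact hac (h.eq_of_coupled s₁ ⟨s.misses, s₂.adj, s₂.isOuter⟩ hy (.inr hne))
  rcases hy with hyy' | ⟨z₁, z₂, hz₁, hz₂, hyz, hzz, hzy⟩
  · refine h.false_of_alternatesVia [(a, x₁), (y₁, y₂), (x₂, y), (x, c)] (by simp) ?_
    simp only [AlternatesVia, linkingEdges, List.map_cons, List.map_nil, List.nodup_cons,
      List.mem_cons, List.not_mem_nil, Sym2.eq_iff]
    grind (splits := 40) [SimpleGraph.adj_comm, SimpleGraph.irrefl, SimpleGraph.compl_adj,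
      h.adj_iff, IsStem, Misses, IsOuter]
  · refine h.false_of_alternatesVia [(a, x₁), (y₁, z₁), (z₂, y₂), (x₂, y), (x, c)] (by simp) ?_
    simp only [AlternatesVia, linkingEdges, List.map_cons, List.map_nil, List.nodup_cons,
      List.mem_cons, List.not_mem_nil, Sym2.eq_iff]
    grind (splits := 40) [SimpleGraph.adj_comm, SimpleGraph.irrefl, SimpleGraph.compl_adj,
      h.adj_iff, IsStem, Misses, IsOuter]

theorem eq_of_coupled_self (h : UnlinkedTwins G p q) (s₁ : IsStem G p q a₁ x₁ y₁)
    (s₂ : IsStem G p q a₂ x₂ y₂) (hy₁ : Coupled G p q y₁ y₁) (hz₂ : IsOuter G p q z₂)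
    (hyz₂ : G.Adj y₁ z₂) (hzy₂ : Gᶜ.Adj z₂ y₂) (hne : y₁ ≠ y₂) : a₁ = a₂ := by
  by_contra hac
  have hx₂ := h.ne_and_not_adj_of_misses s₂.misses
  obtain hirrefl | ⟨z, z', hz, hz', hyz, hzz', hzy⟩ := hy₁
  · exact hirrefl.ne rfl
  refine h.false_of_alternatesVia [(a₁, x₁), (y₁, z), (z', y₁), (z₂, y₂), (x₂, a₂)] (by simp) ?_
  simp only [AlternatesVia, linkingEdges, List.map_cons, List.map_nil, List.nodup_cons,
    List.mem_cons, List.not_mem_nil, Sym2.eq_iff]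
  grind (splits := 40) [SimpleGraph.adj_comm, SimpleGraph.irrefl, SimpleGraph.compl_adj,
    h.adj_iff, IsStem, Misses, IsOuter]

theorem not_adj_of_isBlossom (h : UnlinkedTwins G p q) (ha : IsBlossom G p a x₁ x₂)
    (hb : Misses G p c b) (hac : a ≠ c) : ¬ G.Adj a b := by
  intro hab
  refine h.false_of_alternatesVia [(a, x₁), (x₂, a), (b, c)] (by simp) ?_
  simp only [AlternatesVia, linkingEdges, List.map_cons, List.map_nil, List.nodup_cons,
    List.mem_cons, List.not_mem_nil, Sym2.eq_iff]
  grind (splits := 40) [SimpleGraph.adj_comm, SimpleGraph.irrefl, SimpleGraph.compl_adj,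
    h.adj_iff, Misses, IsBlossom]

theorem false_of_misses (h : UnlinkedTwins G p q) (hz : Misses G p a z) (hzz' : G.Adj z z')
    (hzy : Gᶜ.Adj z' y) (s : IsStem G p q c x y) (hac : a ≠ c) (hzx : z ≠ x) : False := by
  have hzp := h.ne_and_not_adj_of_misses hz
  refine h.false_of_alternatesVia [(a, z), (z', y), (x, c)] (by simp) ?_
  simp only [AlternatesVia, linkingEdges, List.map_cons, List.map_nil, List.nodup_cons,
    List.mem_cons, List.not_mem_nil, Sym2.eq_iff]
  grind (splits := 40) [SimpleGraph.adj_comm, SimpleGraph.irrefl, SimpleGraph.compl_adj,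
    h.adj_iff, IsStem, Misses, IsOuter]

theorem not_coupled_self_of_isBlossom (h : UnlinkedTwins G p q) (ha : IsBlossom G p a x₁ x₂)
    (s : IsStem G p q c u y) (hac : a ≠ c) : ¬ Coupled G p q y y := by
  intro hy
  have hup := h.ne_and_not_adj_of_misses s.misses
  obtain hirrefl | ⟨z, z', hz, hz', hyz, hzz', hzy⟩ := hy
  · exact hirrefl.ne rfl
  refine h.false_of_alternatesVia [(a, x₁), (x₂, a), (y, z), (z', y), (u, c)] (by simp) ?_
  simp only [AlternatesVia, linkingEdges, List.map_cons, List.map_nil, List.nodup_cons,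
    List.mem_cons, List.not_mem_nil, Sym2.eq_iff]
  grind (splits := 40) [SimpleGraph.adj_comm, SimpleGraph.irrefl, SimpleGraph.compl_adj,
    h.adj_iff, IsStem, Misses, IsOuter, IsBlossom]

theorem eq_of_coupled_of_ne (h : UnlinkedTwins G p q) (s₁ : IsStem G p q a₁ x₁ y₁)
    (s : IsStem G p q b x y) (hy : Coupled G p q y₁ y) (hne : y₁ ≠ y)
    (s₂ : IsStem G p q a₂ x₂ y₂) (hy₂ : IsBound G p q y₂) : a₁ = a₂ := by
  by_contra ha
  obtain rfl : b = a₁ := h.eq_of_coupled s s₁ hy.symm (.inr hne.symm)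
  have hx₁ : ∀ c, Misses G p c x₁ → c = b := fun c hc =>
    h.eq_of_coupled ⟨hc, s₁.adj, s₁.isOuter⟩ s hy (.inr hne)
  have s₁₂ : IsStem G p q b x₁ y₂ :=
    ⟨s₁.misses, h.adj_of_coupled s s₁ hy.symm hne.symm s₂ ha, s₂.isOuter⟩
  have hx : x₁ ≠ x₂ := fun hx => ha (hx₁ a₂ (hx ▸ s₂.misses)).symm
  obtain ⟨b', x', y', s', hy'⟩ := hy₂
  by_cases hyy' : y₂ = y'
  · exact ha (h.eq_of_coupled s₁₂ s₂ (hyy' ▸ hy') (.inl hx))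
  · exact ha ((h.eq_of_coupled s₁₂ s' hy' (.inr hyy')).trans
      (h.eq_of_coupled s₂ s' hy' (.inr hyy')).symm)

theorem eq_and_eq_of_isBound (h : UnlinkedTwins G p q) (s₁ : IsStem G p q a₁ x₁ y₁)
    (h₁ : IsBound G p q y₁) (s₂ : IsStem G p q a₂ x₂ y₂) (h₂ : IsBound G p q y₂) (ha : a₁ ≠ a₂) :
    x₁ = x₂ ∧ y₁ = y₂ := by
  obtain ⟨b₁, u₁, y₁', t₁, hy₁⟩ := h₁
  obtain ⟨b₂, u₂, y₂', t₂, hy₂⟩ := h₂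
  obtain rfl : y₁ = y₁' := by
    by_contra hne
    exact ha (h.eq_of_coupled_of_ne s₁ t₁ hy₁ hne s₂ ⟨b₂, u₂, y₂', t₂, hy₂⟩)
  obtain rfl : y₂ = y₂' := by
    by_contra hne
    exact ha (h.eq_of_coupled_of_ne s₂ t₂ hy₂ hne s₁ ⟨b₁, u₁, y₁, t₁, hy₁⟩).symm
  by_cases hy : y₁ = y₂
  · subst hy
    exact ⟨by_contra fun hx => ha (h.eq_of_coupled s₁ s₂ hy₁ (.inl hx)), rfl⟩
  have hnc : ¬ Coupled G p q y₁ y₂ := fun hc => ha (h.eq_of_coupled s₁ s₂ hc (.inr hy))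
  obtain hirrefl | ⟨z, z', hz, hz', hyz, hzz', hzy⟩ := hy₂
  · exact (hirrefl.ne rfl).elim
  have hy₁z : G.Adj y₁ z := by
    by_contra hn
    have hne : y₁ ≠ z := fun he => hnc (.inl (he ▸ hyz.symm))
    exact hnc (.inr ⟨z, z', hz, hz', ⟨hne, hn⟩, hzz', hzy⟩)
  exact (ha (h.eq_of_coupled_self s₁ s₂ hy₁ hz hy₁z hyz.symm hy)).elim

theorem exists_forall_eq_of_isBound (h : UnlinkedTwins G p q) :
    ∃ A ⊆ G.neighborSet p, (G.neighborSet p \ A).Subsingleton ∧ ∃ x₀ y₀, ∀ a ∈ A, ∀ x y,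
      IsStem G p q a x y → IsBound G p q y → x = x₀ ∧ y = y₀ := by
  by_cases hsingle : ∃ a₀, ∀ a x y, IsStem G p q a x y → IsBound G p q y → a = a₀
  · obtain ⟨a₀, ha₀⟩ := hsingle
    refine ⟨G.neighborSet p \ {a₀}, Set.sdiff_subset,
      subsingleton_sdiff_sdiff_singleton _ _, p, p, fun a ha x y s hy => ?_⟩
    exact (ha.2 (ha₀ a x y s hy)).elim
  · push Not at hsingle
    obtain ⟨a₀, x₀, y₀, s₀, h₀, -⟩ := hsingle p
    obtain ⟨a₁, x₁, y₁, s₁, h₁, hne⟩ := hsingle a₀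
    obtain ⟨rfl, rfl⟩ := h.eq_and_eq_of_isBound s₁ h₁ s₀ h₀ hne
    refine ⟨G.neighborSet p, subset_rfl, by simp, x₁, y₁, fun a _ x y s hy => ?_⟩
    by_cases ha : a = a₀
    · exact h.eq_and_eq_of_isBound s hy s₁ h₁ (ha ▸ hne.symm)
    · exact h.eq_and_eq_of_isBound s hy s₀ h₀ ha

end UnlinkedTwins

end Exclusion

section SaturatedPair

variable {V : Type*} {G : SimpleGraph V} {p q : V} {A C : Set V}

/-- `Y` is a clique and `Z` is an independent set, and up to a few pairs each vertex outside `Y`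
and `Z` is adjacent to all of `Y` (to all of `A` if it is in `Z \ X`), while the vertices of `X`
have almost no neighbours outside `Y`. -/
structure SaturatedPair (G : SimpleGraph V) (p q : V) (A X Y Z : Set V) : Prop where
  subset_hub : A ⊆ Y
  subset_neighborSet : A ⊆ G.neighborSet p
  diff_subsingleton : (G.neighborSet p \ A).Subsingleton
  subset_rim : X ⊆ Z
  left_mem : p ∈ X
  right_mem : q ∈ X
  disjoint : Disjoint Y Z
  isClique : G.IsClique Y
  isIndepSet : G.IsIndepSet Z
  adj_of_notMem : ∀ a ∈ A, ∀ v ∉ Y, v ∉ X → G.Adj a v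
  hub_adj_of_notMem : ∀ y ∈ Y, ∀ v ∉ Y, v ∉ Z → G.Adj y v
  exists_forall_eq : ∃ u₀ t₀, ∀ u ∈ X, ∀ t ∉ Y, G.Adj u t → u = u₀ ∧ t = t₀

/-- The clique of a saturated pair: neighbours `C` of `p` together with the ends that are not
bound of stems through `A`. -/
def hub (G : SimpleGraph V) (p q : V) (A C : Set V) : Set V :=
  C ∪ {y | ¬ IsBound G p q y ∧ ∃ a ∈ A, ∃ x, IsStem G p q a x y}

/-- The vertices with almost no neighbours outside the hub: `p`, `q` and the vertices that are not
adjacent to some vertex of `A`. -/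
def fringe (G : SimpleGraph V) (p q : V) (A : Set V) : Set V :=
  {p, q} ∪ {x | ∃ a ∈ A, Misses G p a x}

/-- The independent set of a saturated pair: the fringe and the vertices outside the hub that are
not adjacent to all of it. -/
def rim (G : SimpleGraph V) (p q : V) (A C : Set V) : Set V :=
  fringe G p q A ∪ {v | v ∉ hub G p q A C ∧ ∃ y ∈ hub G p q A C, ¬ G.Adj y v}

namespace UnlinkedTwins

theorem not_adj (h : UnlinkedTwins G p q) : ¬ G.Adj p q := fun hpq =>
  G.irrefl ((h.adj_iff q).1 hpq)

theorem not_adj_of_mem_fringe (h : UnlinkedTwins G p q) {x : V} (hx : x ∈ fringe G p q A) :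
    ¬ G.Adj p x := by
  rcases hx with (rfl | rfl) | ⟨a, _, hax⟩
  · exact G.irrefl
  · exact h.not_adj
  · exact (h.ne_and_not_adj_of_misses hax).2.2

theorem adj_of_mem_hub (h : UnlinkedTwins G p q) (hC : C ⊆ G.neighborSet p) {y v : V}
    (hy : y ∈ hub G p q A C) (hv : G.Adj p v) (hne : y ≠ v) : G.Adj y v := by
  rcases hy with hy | ⟨-, a, -, x, s⟩
  · exact h.isClique_neighborSet (hC hy) hv hne
  · exact (s.isOuter.adj hv).symm

theorem not_adj_of_mem_rim (h : UnlinkedTwins G p q) (hC : C ⊆ G.neighborSet p) {v : V}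
    (hv : v ∈ rim G p q A C) : ¬ G.Adj p v := by
  rcases hv with hv | ⟨hvY, y, hy, hyv⟩
  · exact h.not_adj_of_mem_fringe hv
  · exact fun hpv => hyv (h.adj_of_mem_hub hC hy hpv (ne_of_mem_of_not_mem hy hvY))

theorem disjoint_hub_rim (h : UnlinkedTwins G p q) (hC : C ⊆ G.neighborSet p) :
    Disjoint (hub G p q A C) (rim G p q A C) := by
  refine Set.disjoint_left.2 fun v hvY hvZ => ?_
  rcases hvY with hvC | hv
  · exact h.not_adj_of_mem_rim hC hvZ (hC hvC)
  obtain ⟨b, x, s⟩ : ∃ b x, IsStem G p q b x v := by grind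
  rcases hvZ with ((rfl | rfl) | ⟨a, _, hav⟩) | hv'
  · exact s.isOuter.ne_left rfl
  · exact s.isOuter.ne_right rfl
  · exact hav.2.2 (s.isOuter.adj hav.1)
  · exact hv'.1 (.inr hv)

theorem isClique_hub (h : UnlinkedTwins G p q) (hC : C ⊆ G.neighborSet p) :
    G.IsClique (hub G p q A C) := by
  rintro y hy y' (hy' | ⟨-, a', -, x', s'⟩) hne
  · exact h.adj_of_mem_hub hC hy (hC hy') hne
  rcases hy with hy | ⟨hfree, -⟩
  · exact s'.isOuter.adj (hC hy)
  · by_contra hn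
    exact hfree ⟨a', x', y', s', .inl ⟨hne, hn⟩⟩

theorem isStem_of_not_misses (h : UnlinkedTwins G p q) {a u t : V} (hau : Misses G p a u)
    (hut : G.Adj u t) (hpt : ¬ G.Adj p t) (hmiss : ∀ b, ¬ Misses G p b t) :
    IsStem G p q a u t := by
  have hpu := (h.ne_and_not_adj_of_misses hau).2.2
  refine ⟨hau, hut, isOuter_of_not_misses ?_ ?_ hpt hmiss⟩
  · rintro rfl
    exact hpu hut.symm
  · rintro rfl
    exact hpu ((h.adj_iff u).2 hut.symm)

theorem isIndepSet_rim (h : UnlinkedTwins G p q) (hC : C ⊆ G.neighborSet p)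
    (hmiss : ∀ u ∈ rim G p q A C, ∀ v ∈ rim G p q A C, ∀ a b, Misses G p a u → Misses G p b v →
      ¬ G.Adj u v) : G.IsIndepSet (rim G p q A C) := by
  have hor : ∀ u ∈ rim G p q A C, ∀ v ∈ rim G p q A C, G.Adj u v → (∃ a, Misses G p a u) ∨
      IsOuter G p q u ∧ ∃ y, ¬ IsBound G p q y ∧ (∃ a x, IsStem G p q a x y) ∧ Gᶜ.Adj y u := by
    intro u hu v hv huv
    have hpv := h.not_adj_of_mem_rim hC hv
    have hup : u ≠ p := by rintro rfl; exact hpv huv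
    have huq : u ≠ q := by rintro rfl; exact hpv ((h.adj_iff v).2 huv)
    refine or_iff_not_imp_left.2 fun hno => ?_
    push Not at hno
    have hout := isOuter_of_not_misses hup huq (h.not_adj_of_mem_rim hC hu) hno
    rcases hu with ((rfl | rfl) | ⟨a, _, hau⟩) | ⟨huY, y, hy, hyu⟩
    · exact (hup rfl).elim
    · exact (huq rfl).elim
    · exact (hno a hau).elim
    rcases id hy with hyC | ⟨hfree, a, -, x, s⟩
    · exact (hyu (hout.adj (hC hyC))).elim
    · exact ⟨hout, y, hfree, ⟨a, x, s⟩, ne_of_mem_of_not_mem hy huY, hyu⟩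
  intro u hu v hv _ huv
  rcases hor u hu v hv huv with ⟨a, hau⟩ | ⟨hou, y, hfree, -, hyu⟩ <;>
  rcases hor v hv u hu huv.symm with ⟨b, hbv⟩ | ⟨hov, y', hfree', ⟨b, x', s'⟩, hyv⟩
  · exact hmiss u hu v hv a b hau hbv huv
  · exact hfree' ⟨a, u, v, ⟨hau, huv, hov⟩, .inl hyv⟩
  · exact hfree ⟨b, v, u, ⟨hbv, huv.symm, hou⟩, .inl hyu⟩
  · exact hfree ⟨b, x', y', s', .inr ⟨u, v, hou, hov, hyu, huv, hyv.symm⟩⟩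

theorem saturatedPair (h : UnlinkedTwins G p q) (hAC : A ⊆ C) (hC : C ⊆ G.neighborSet p)
    (hA : (G.neighborSet p \ A).Subsingleton) (hZ : G.IsIndepSet (rim G p q A C))
    (hX : ∃ u₀ t₀, ∀ u ∈ fringe G p q A, ∀ t ∉ hub G p q A C, G.Adj u t → u = u₀ ∧ t = t₀) :
    SaturatedPair G p q A (fringe G p q A) (hub G p q A C) (rim G p q A C) where
  subset_hub := hAC.trans Set.subset_union_left
  subset_neighborSet := hAC.trans hC
  diff_subsingleton := hA
  subset_rim := Set.subset_union_left
  left_mem := by simp [fringe]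
  right_mem := by simp [fringe]
  disjoint := h.disjoint_hub_rim hC
  isClique := h.isClique_hub hC
  isIndepSet := hZ
  adj_of_notMem a ha v hvY hvX := by_contra fun hav =>
    hvX (.inr ⟨a, ha, hC (hAC ha), fun he => hvY (.inl (he ▸ hAC ha)), hav⟩)
  hub_adj_of_notMem y hy v hvY hvZ := by_contra fun hyv => hvZ (.inr ⟨hvY, y, hy, hyv⟩)
  exists_forall_eq := hX

theorem exists_saturatedPair_of_isIndep (h : UnlinkedTwins G p q)
    (hmiss : ∀ a b u v, Misses G p a u → Misses G p b v → ¬ G.Adj u v) :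
    ∃ A X Y Z, SaturatedPair G p q A X Y Z := by
  obtain ⟨A, hAN, hA, x₀, y₀, hunique⟩ := h.exists_forall_eq_of_isBound
  refine ⟨A, _, _, _, h.saturatedPair hAN subset_rfl hA
    (h.isIndepSet_rim subset_rfl fun u _ v _ a b => hmiss a b u v)
    ⟨x₀, y₀, fun u hu t ht hut => ?_⟩⟩
  have hpt : ¬ G.Adj p t := fun hpt => ht (.inl hpt)
  rcases hu with (rfl | rfl) | ⟨a, ha, hau⟩
  · exact (hpt hut).elim
  · exact (hpt ((h.adj_iff t).2 hut)).elim
  have s := h.isStem_of_not_misses hau hut hpt fun b hbt => hmiss a b u t hau hbt hut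
  exact hunique a ha u t s (by_contra fun hfree => ht (.inr ⟨hfree, a, ha, u, s⟩))

section Blossom

variable {a b c u v x x₁ x₂ y : V}

theorem misses_of_isBlossom (h : UnlinkedTwins G p q) (ha : IsBlossom G p a x₁ x₂) (hc : c ≠ a)
    (hu : Misses G p c u) : Misses G p a u :=
  have hpa := ha.misses_left.1
  ⟨hpa, fun he => hu.2.2 (h.isClique_neighborSet hu.1 (he ▸ hpa) hu.2.1),
    h.not_adj_of_isBlossom ha hu hc.symm⟩

theorem not_adj_of_misses_of_isBlossom (h : UnlinkedTwins G p q) (ha : IsBlossom G p a x₁ x₂)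
    (hc : c ≠ a) (hu : Misses G p c u) (hv : Misses G p b v) : ¬ G.Adj u v := fun huv =>
  hc ((h.eq_of_misses hu hv huv).1.trans
    (h.eq_of_misses (h.misses_of_isBlossom ha hc hu) hv huv).1.symm)

theorem not_isBound_of_isBlossom (h : UnlinkedTwins G p q) (ha : IsBlossom G p a x₁ x₂)
    (hc : c ≠ a) (s : IsStem G p q c x y) : ¬ IsBound G p q y := by
  rintro ⟨b, x', y', s', hy⟩
  by_cases hyy' : y = y'
  · exact h.not_coupled_self_of_isBlossom ha s hc.symm (hyy' ▸ hy)
  · have sa : IsStem G p q a x y := ⟨h.misses_of_isBlossom ha hc s.misses, s.adj, s.isOuter⟩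
    exact hc ((h.eq_of_coupled s s' hy (.inr hyy')).trans
      (h.eq_of_coupled sa s' hy (.inr hyy')).symm)

theorem isIndepSet_rim_of_isBlossom (h : UnlinkedTwins G p q) (ha : IsBlossom G p a x₁ x₂) :
    G.IsIndepSet (rim G p q (G.neighborSet p \ {a}) (G.neighborSet p \ {a})) := by
  refine h.isIndepSet_rim Set.sdiff_subset fun u _ v hv b b' hbu hbv huv => ?_
  have hu : ∀ c, Misses G p c u → c = a := fun c hcu => by_contra fun hc =>
    h.not_adj_of_misses_of_isBlossom ha hc hcu hbv huv
  have hv' : ∀ c, Misses G p c v → c = a := fun c hcv => by_contra fun hc =>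
    h.not_adj_of_misses_of_isBlossom ha hc hcv hbu huv.symm
  obtain rfl := hu b hbu
  rcases hv with ((rfl | rfl) | ⟨c, hc, hcv⟩) | ⟨hvY, y, hy, hyv⟩
  · exact (h.ne_and_not_adj_of_misses hbv).1 rfl
  · exact (h.ne_and_not_adj_of_misses hbv).2.1 rfl
  · exact hc.2 (hv' c hcv)
  have hne := ne_of_mem_of_not_mem hy hvY
  rcases hy with hyA | ⟨-, c, hc, x, s⟩
  · exact hyA.2 (hv' y ⟨hyA.1, hne, hyv⟩)
  · refine h.false_of_misses hbu huv ⟨hne.symm, mt .symm hyv⟩ s (Ne.symm hc.2) ?_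
    rintro rfl
    exact hc.2 (hu c s.misses)

theorem exists_saturatedPair_of_isBlossom (h : UnlinkedTwins G p q)
    (ha : IsBlossom G p a x₁ x₂) : ∃ A X Y Z, SaturatedPair G p q A X Y Z := by
  refine ⟨G.neighborSet p \ {a}, _, _, _, h.saturatedPair subset_rfl Set.sdiff_subset
    (subsingleton_sdiff_sdiff_singleton _ _) (h.isIndepSet_rim_of_isBlossom ha)
    ⟨p, a, fun u hu t ht hut => ?_⟩⟩
  obtain ⟨-, rfl⟩ := h.eq_of_misses ha.misses_left ha.misses_right ha.adj
  rcases hu with (rfl | rfl) | ⟨c, hc, hcu⟩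
  · exact ⟨rfl, by_contra fun hta => ht (.inl ⟨hut, hta⟩)⟩
  · exact ⟨rfl, by_contra fun hta => ht (.inl ⟨hut, hta⟩)⟩
  have hpt : ¬ G.Adj p t := fun hpt =>
    ht (.inl ⟨hpt, fun he => (h.misses_of_isBlossom ha hc.2 hcu).2.2 (he ▸ hut.symm)⟩)
  have s := h.isStem_of_not_misses hcu hut hpt fun b hbt =>
    h.not_adj_of_misses_of_isBlossom ha hc.2 hcu hbt hut
  exact (ht (.inr ⟨h.not_isBound_of_isBlossom ha hc.2 s, c, hc, u, s⟩)).elim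

end Blossom

theorem exists_saturatedPair (h : UnlinkedTwins G p q) :
    ∃ A X Y Z, SaturatedPair G p q A X Y Z := by
  by_cases hmiss : ∀ a b u v, Misses G p a u → Misses G p b v → ¬ G.Adj u v
  · exact h.exists_saturatedPair_of_isIndep hmiss
  · push Not at hmiss
    obtain ⟨a, b, u, v, hu, hv, huv⟩ := hmiss
    obtain ⟨rfl, -⟩ := h.eq_of_misses hu hv huv
    exact h.exists_saturatedPair_of_isBlossom ⟨hu, hv, huv⟩

end UnlinkedTwins

end SaturatedPair

section Counting

open Finset

variable {V : Type*} {G : SimpleGraph V} [DecidableRel G.Adj]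

theorem card_interedges_comm (U T : Finset V) : #(G.interedges U T) = #(G.interedges T U) :=
  have := G.symm
  Rel.card_interedges_comm U T

theorem card_interedges_eq_sum (U T : Finset V) :
    #(G.interedges U T) = ∑ u ∈ U, #{t ∈ T | G.Adj u t} := by
  simp only [SimpleGraph.interedges_def, card_filter, sum_product]

theorem card_interedges_add_card_le {U T : Finset V} (hUT : U ⊆ T) :
    #(G.interedges U T) + #U ≤ #U * #T := by
  rw [card_interedges_eq_sum, card_eq_sum_ones U, ← sum_add_distrib, ← card_eq_sum_ones,
    ← smul_eq_mul]
  exact sum_le_card_nsmul U _ _ fun u hu => card_lt_card (filter_ssubset.2 ⟨u, hUT hu, G.irrefl⟩)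

theorem card_interedges_add_card {U T : Finset V} (hUT : U ⊆ T)
    (hadj : ∀ u ∈ U, ∀ t ∈ T, u ≠ t → G.Adj u t) : #(G.interedges U T) + #U = #U * #T := by
  classical
  rw [card_interedges_eq_sum, card_eq_sum_ones U, ← sum_add_distrib, ← card_eq_sum_ones,
    ← smul_eq_mul]
  refine sum_eq_card_nsmul fun u hu => ?_
  have herase : {t ∈ T | G.Adj u t} = T.erase u := by grind [SimpleGraph.irrefl]
  rw [herase, card_erase_add_one (hUT hu)]

variable [Fintype V]

theorem sum_degree_eq_card_interedges (U : Finset V) :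
    ∑ u ∈ U, G.degree u = #(G.interedges U univ) := by
  simp only [card_interedges_eq_sum, ← SimpleGraph.card_neighborFinset_eq_degree,
    SimpleGraph.neighborFinset_eq_filter]

theorem card_interedges_add_compl [DecidableEq V] (U T : Finset V) :
    #(G.interedges U T) + #(G.interedges U Tᶜ) = ∑ u ∈ U, G.degree u := by
  rw [sum_degree_eq_card_interedges, ← card_union_of_disjoint
    (G.interedges_disjoint_right U disjoint_compl_right)]
  congr 1
  ext e
  simp only [mem_union, SimpleGraph.mem_interedges_iff, mem_compl, mem_univ]
  tauto

/-- One of the inequalities of Erdős and Gallai. -/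
theorem sum_degree_add_le {Y Z : Finset V} (hYZ : Disjoint Y Z) :
    ∑ y ∈ Y, G.degree y + #Y * #Z + #Y ≤ #Y * Fintype.card V + ∑ z ∈ Z, G.degree z := by
  classical
  have hY := card_interedges_add_compl (G := G) Y Z
  have hZ := card_interedges_add_compl (G := G) Z Y
  have hcomm := card_interedges_comm (G := G) Y Z
  have hle := card_interedges_add_card_le (G := G) (subset_compl_iff_disjoint_right.2 hYZ)
  have hcard : #Y * #Z + #Y * #Zᶜ = #Y * Fintype.card V := by
    rw [← mul_add, card_add_card_compl]
  omega

namespace SaturatedPair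

variable {p q : V} {A X Y Z : Finset V} {c : ℕ}

theorem degree_left_le (h : SaturatedPair G p q A X Y Z) : G.degree p ≤ #A + 1 := by
  classical
  have hsub : #(G.neighborFinset p \ A) ≤ 1 := card_le_one.2 fun u hu v hv =>
    h.diff_subsingleton (by simpa using hu) (by simpa using hv)
  have hle := card_le_card_sdiff_add_card (s := G.neighborFinset p) (t := A)
  rw [SimpleGraph.card_neighborFinset_eq_degree] at hle
  omega

theorem card_interedges_fringe_le_one [DecidableEq V] (h : SaturatedPair G p q A X Y Z) :
    #(G.interedges X Yᶜ) ≤ 1 := by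
  obtain ⟨u₀, t₀, heq⟩ := h.exists_forall_eq
  suffices hsub : G.interedges X Yᶜ ⊆ {(u₀, t₀)} from card_le_card hsub
  intro e he
  obtain ⟨hu, ht, hadj⟩ := (G.mem_interedges_iff).1 he
  exact mem_singleton.2 (Prod.ext_iff.2 (heq _ hu _ (by simpa using ht) hadj))

theorem card_mul_add_two_le [DecidableEq V] (h : SaturatedPair G p q A X Y Z) (hA : c ≤ #A)
    (hX : #X * c + 2 ≤ ∑ x ∈ X, G.degree x) {T : Finset V} (hXT : X ⊆ T) (hT : Disjoint Y T) :
    #T * c + 2 ≤ #(G.interedges T Y) + #(G.interedges X Yᶜ) := by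
  have hrest : #(T \ X) * c ≤ ∑ t ∈ T \ X, #{y ∈ Y | G.Adj t y} := by
    refine card_nsmul_le_sum _ _ _ fun t ht => hA.trans (card_le_card fun a ha => ?_)
    obtain ⟨htT, htX⟩ := mem_sdiff.1 ht
    exact mem_filter.2 ⟨h.subset_hub ha,
      (h.adj_of_notMem a ha t (disjoint_right.1 hT htT) htX).symm⟩
  have hsplit := sum_sdiff (f := fun t => #{y ∈ Y | G.Adj t y}) hXT
  simp only [← card_interedges_eq_sum] at hsplit hrest
  have hdeg := card_interedges_add_compl (G := G) X Y
  have hcard := card_sdiff_add_card_eq_card hXT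
  have : #T * c = #(T \ X) * c + #X * c := by rw [← hcard, add_mul]
  omega

theorem sq_add_le_sum_degree [DecidableEq V] (h : SaturatedPair G p q A X Y Z) (hA : c ≤ #A)
    (hX : #X * c + 2 ≤ ∑ x ∈ X, G.degree x) :
    #Y * #Y + 2 * (#Yᶜ * c) + 3 ≤ ∑ v, G.degree v + #Y := by
  have hXY : X ⊆ Yᶜ := fun x hx =>
    mem_compl.2 (disjoint_right.1 (disjoint_coe.1 h.disjoint) (h.subset_rim hx))
  have hcross := h.card_mul_add_two_le hA hX hXY disjoint_compl_right
  have hone := h.card_interedges_fringe_le_one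
  have hmono := card_le_card (G.interedges_mono hXY (subset_refl Yᶜ))
  have hclique := card_interedges_add_card (subset_refl Y) h.isClique
  have hY := card_interedges_add_compl (G := G) Y Y
  have hYc := card_interedges_add_compl (G := G) Yᶜ Y
  have hcomm := card_interedges_comm (G := G) Y Yᶜ
  have hsum := sum_add_sum_compl Y fun v => G.degree v
  omega

theorem card_mul_add_le_sum_degree_hub (h : SaturatedPair G p q A X Y Z) (hA : c ≤ #A)
    (hX : #X * c + 2 ≤ ∑ x ∈ X, G.degree x) :
    #Y * Fintype.card V + #Z * c + 1 ≤ ∑ y ∈ Y, G.degree y + #Y * #Z + #Y := by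
  classical
  have hYZ : Disjoint Y Z := disjoint_coe.1 h.disjoint
  have hcross := h.card_mul_add_two_le hA hX h.subset_rim hYZ
  have hone := h.card_interedges_fringe_le_one
  have hsat : #(G.interedges Y Zᶜ) + #Y = #Y * #Zᶜ :=
    card_interedges_add_card (subset_compl_iff_disjoint_right.2 hYZ) fun y hy v hv hne => by
      by_cases hvY : v ∈ Y
      · exact h.isClique hy hvY hne
      · exact h.hub_adj_of_notMem y hy v hvY (mem_compl.1 hv)
  have hY := card_interedges_add_compl (G := G) Y Z
  have hcomm := card_interedges_comm (G := G) Y Z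
  have hcard : #Y * #Z + #Y * #Zᶜ = #Y * Fintype.card V := by
    rw [← mul_add, card_add_card_compl]
  omega

theorem card_le_card_fringe_add (h : SaturatedPair G p q A X Y Z) (hA : A.Nonempty)
    (hc : ∀ v ∉ X, G.degree v ≤ c) : Fintype.card V ≤ #X + c := by
  classical
  obtain ⟨a, ha⟩ := hA
  have haX : a ∉ X := fun haX => disjoint_left.1 (disjoint_coe.1 h.disjoint) (h.subset_hub ha)
    (h.subset_rim haX)
  have hpX : p ∉ Xᶜ.erase a := fun hp => mem_compl.1 (mem_of_mem_erase hp) h.left_mem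
  have hsub : insert p (Xᶜ.erase a) ⊆ G.neighborFinset a := by
    intro v hv
    rw [SimpleGraph.mem_neighborFinset]
    rcases mem_insert.1 hv with rfl | hv
    · exact (h.subset_neighborSet ha).symm
    obtain ⟨hva, hvX⟩ := mem_erase.1 hv
    by_cases hvY : v ∈ Y
    · exact h.isClique (h.subset_hub ha) hvY hva.symm
    · exact h.adj_of_notMem a ha v hvY (mem_compl.1 hvX)
  have hcard := card_le_card hsub
  rw [card_insert_of_notMem hpX, card_erase_add_one (mem_compl.2 haX),
    SimpleGraph.card_neighborFinset_eq_degree] at hcard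
  have hcompl := card_add_card_compl X
  have hdeg := hc a haX
  omega

theorem card_filter_rim_add_le [DecidableEq V] (h : SaturatedPair G p q A X Y Z)
    (hA : A.Nonempty) (hc : ∀ v ∉ X, G.degree v ≤ c) {v : V} (hv : v ∉ Z) :
    #{z ∈ Z | G.Adj v z} + #Zᶜ ≤ c + 1 := by
  have hcompl := card_add_card_compl Z
  by_cases hvY : v ∈ Y
  · have hdeg := card_interedges_add_compl (G := G) {v} Z
    have hsat : #(G.interedges {v} Zᶜ) + #{v} = #{v} * #Zᶜ :=
      card_interedges_add_card (by simpa using hv) fun y hy t ht hne => by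
        obtain rfl := mem_singleton.1 hy
        by_cases htY : t ∈ Y
        · exact h.isClique hvY htY hne
        · exact h.hub_adj_of_notMem y hvY t htY (mem_compl.1 ht)
    have hle := hc v fun hvX => hv (h.subset_rim hvX)
    rw [card_interedges_eq_sum] at hdeg
    simp only [sum_singleton, card_singleton, one_mul] at hdeg hsat
    omega
  · obtain ⟨u₀, t₀, heq⟩ := h.exists_forall_eq
    have hsub : ({z ∈ Z | G.Adj v z} : Finset V) ⊆ insert u₀ (Z \ X) := by
      intro z hz
      obtain ⟨hzZ, hvz⟩ := mem_filter.1 hz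
      by_cases hzX : z ∈ X
      · exact mem_insert.2 (.inl (heq z hzX v hvY hvz.symm).1)
      · exact mem_insert_of_mem (mem_sdiff.2 ⟨hzZ, hzX⟩)
    have hle := (card_le_card hsub).trans (card_insert_le _ _)
    have hsdiff := card_sdiff_add_card_eq_card (coe_subset.1 h.subset_rim)
    have hfringe := h.card_le_card_fringe_add hA hc
    omega

theorem sum_degree_add_sq_le [DecidableEq V] (h : SaturatedPair G p q A X Y Z)
    (hA : A.Nonempty) (hc : ∀ v ∉ X, G.degree v ≤ c) :
    ∑ v, G.degree v + #Zᶜ * #Zᶜ ≤ 2 * (#Zᶜ * c) + #Zᶜ := by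
  have hindep : #(G.interedges Z Z) = 0 := by
    refine card_eq_zero.2 (eq_empty_of_forall_notMem fun e he => ?_)
    obtain ⟨he₁, he₂, hadj⟩ := (G.mem_interedges_iff).1 he
    exact h.isIndepSet he₁ he₂ hadj.ne hadj
  have hZ := card_interedges_add_compl (G := G) Z Z
  have hcross : #(G.interedges Z Zᶜ) + #Zᶜ * #Zᶜ ≤ #Zᶜ * (c + 1) := by
    rw [card_interedges_comm, card_interedges_eq_sum, ← smul_eq_mul, ← sum_const,
      ← sum_add_distrib, ← smul_eq_mul (b := c + 1)]
    exact sum_le_card_nsmul _ _ _ fun v hv =>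
      h.card_filter_rim_add_le hA hc (mem_compl.1 hv)
  have hdeg : ∑ v ∈ Zᶜ, G.degree v ≤ #Zᶜ * c := sum_le_card_nsmul _ _ _ fun v hv =>
    hc v fun hvX => mem_compl.1 hv (h.subset_rim hvX)
  have hsum := sum_add_sum_compl Z fun v => G.degree v
  rw [mul_add_one] at hcross
  omega

end SaturatedPair

end Counting

section Region

open Finset

theorem exists_between_sum_eq {ι : Type*} (s : Finset ι) (f g : ι → ℕ) (hfg : f ≤ g) (t : ℕ)
    (hf : ∑ i ∈ s, f i ≤ t) (hg : t ≤ ∑ i ∈ s, g i) :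
    ∃ h : ι → ℕ, f ≤ h ∧ h ≤ g ∧ ∑ i ∈ s, h i = t := by
  classical
  induction t, hf using Nat.le_induction with
  | base => exact ⟨f, le_rfl, hfg, rfl⟩
  | succ t _ ih =>
    obtain ⟨h, hfh, hhg, hsum⟩ := ih (by omega)
    obtain ⟨i, hi, hlt⟩ : ∃ i ∈ s, h i < g i := exists_lt_of_sum_lt (by omega)
    refine ⟨h + Pi.single i 1, fun j => (hfh j).trans (by simp), fun j => ?_, ?_⟩
    · rcases eq_or_ne j i with rfl | hj
      · simpa using hlt
      · simpa [hj] using hhg j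
    · simp [sum_add_distrib, hsum, sum_pi_single', hi]

variable {n S c₁ c₂ : ℕ}

theorem exists_mem_simpleRegion_between (hc₂ : 0 < c₂) (hn : c₁ < n) (hS : Even S)
    {f g : Fin n → ℕ} (hfg : f ≤ g) (hf : ∀ i, c₂ ≤ f i) (hg : ∀ i, g i ≤ c₁)
    (hfS : ∑ i, f i ≤ S) (hgS : S ≤ ∑ i, g i) : ∃ d ∈ simpleRegion n S c₁ c₂, f ≤ d ∧ d ≤ g := by
  obtain ⟨d, hfd, hdg, hsum⟩ := exists_between_sum_eq univ f g hfg S hfS hgS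
  have hbounds : ∀ i, c₂ ≤ d i ∧ d i ≤ c₁ := fun i =>
    ⟨(hf i).trans (hfd i), (hdg i).trans (hg i)⟩
  exact ⟨d, ⟨⟨fun i => ⟨hc₂.trans_le (hbounds i).1, (hbounds i).2.trans_lt hn⟩, hsum ▸ hS⟩,
    hbounds, hsum⟩, hfd, hdg⟩

theorem sum_ite_mem_const {V : Type*} [Fintype V] [DecidableEq V] (T : Finset V) (a b : ℕ) :
    ∑ v, (if v ∈ T then a else b) = #T * a + #Tᶜ * b := by
  rw [sum_ite, sum_const, sum_const, filter_univ_mem, filter_notMem_eq_sdiff, ← compl_eq_univ_sdiff,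
    smul_eq_mul, smul_eq_mul]

theorem exists_mem_simpleRegion_eqOn (hc₂ : 0 < c₂) (hc : c₂ ≤ c₁) (hn : c₁ < n) (hS : Even S)
    {Y Z : Finset (Fin n)} (hYZ : Disjoint Y Z) (hlow : #Y * c₁ + #Yᶜ * c₂ ≤ S)
    (hhigh : S ≤ #Z * c₂ + #Zᶜ * c₁) :
    ∃ d ∈ simpleRegion n S c₁ c₂, (∀ i ∈ Y, d i = c₁) ∧ ∀ i ∈ Z, d i = c₂ := by
  obtain ⟨d, hd, hfd, hdg⟩ := exists_mem_simpleRegion_between hc₂ hn hS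
    (f := fun i => if i ∈ Y then c₁ else c₂) (g := fun i => if i ∈ Z then c₂ else c₁)
    (fun i => by grind [disjoint_left]) (fun i => by grind) (fun i => by grind)
    (by rwa [sum_ite_mem_const]) (by rwa [sum_ite_mem_const])
  exact ⟨d, hd, fun i hi => (hd.2.1 i).2.antisymm (by simpa [hi] using hfd i),
    fun i hi => (hdg i |>.trans_eq (if_pos hi)).antisymm (hd.2.1 i).1⟩

theorem FullyGraphic.sum_add_le {𝔻 : Set (Fin n → ℕ)} (hfull : FullyGraphic 𝔻) {d : Fin n → ℕ}
    (hd : d ∈ 𝔻) {Y Z : Finset (Fin n)} (hYZ : Disjoint Y Z) :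
    ∑ y ∈ Y, d y + #Y * #Z + #Y ≤ #Y * n + ∑ z ∈ Z, d z := by
  classical
  obtain ⟨H, hH⟩ := hfull d hd
  simpa only [Fintype.card_fin, hH _] using sum_degree_add_le (G := H) hYZ

section Bounds

variable {D : Fin n → ℕ} (hc₂ : 0 < c₂) (hc : c₂ ≤ c₁) (hn : c₁ < n)
  (hfull : FullyGraphic (simpleRegion n S c₁ c₂)) (hD : D ∈ simpleRegion n S c₁ c₂)

include hc₂ hc hn hfull hD

theorem FullyGraphic.add_card_le_sq_add (Y : Finset (Fin n)) (hS : S ≤ #Y * c₁ + #Yᶜ * c₂) :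
    S + #Y ≤ #Y * #Y + 2 * (#Yᶜ * c₂) := by
  have hlow : n * c₂ ≤ S := by
    simpa [hD.2.2] using card_nsmul_le_sum univ D c₂ fun i _ => (hD.2.1 i).1
  obtain ⟨d, hd, -, hdY⟩ := exists_mem_simpleRegion_eqOn (Y := ∅) (Z := Yᶜ) hc₂ hc hn
    (hD.2.2 ▸ hD.1.2) (disjoint_empty_left _) (by simpa using hlow)
    (by rwa [compl_compl, add_comm])
  have hle := hfull.sum_add_le hd (disjoint_compl_right (a := Y))
  have hsum := sum_add_sum_compl Y d
  have hcard : #Y * #Y + #Y * #Yᶜ = #Y * n := by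
    rw [← mul_add, card_add_card_compl, Fintype.card_fin]
  rw [hd.2.2] at hsum
  rw [sum_eq_card_nsmul hdY, smul_eq_mul] at hle hsum
  omega

theorem FullyGraphic.two_mul_add_card_le (Z : Finset (Fin n)) (hS : #Z * c₂ + #Zᶜ * c₁ ≤ S) :
    2 * (#Zᶜ * c₁) + #Zᶜ ≤ S + #Zᶜ * #Zᶜ := by
  have hhigh : S ≤ n * c₁ := by
    simpa [hD.2.2] using sum_le_card_nsmul univ D c₁ fun i _ => (hD.2.1 i).2
  obtain ⟨d, hd, hdZ, -⟩ := exists_mem_simpleRegion_eqOn (Y := Zᶜ) (Z := ∅) hc₂ hc hn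
    (hD.2.2 ▸ hD.1.2) (disjoint_empty_right _) (by rwa [compl_compl, add_comm])
    (by simpa using hhigh)
  have hle := hfull.sum_add_le hd (disjoint_compl_left (a := Z))
  have hsum := sum_add_sum_compl Z d
  have hcard : #Zᶜ * #Z + #Zᶜ * #Zᶜ = #Zᶜ * n := by
    rw [← mul_add, card_add_card_compl, Fintype.card_fin]
  rw [hd.2.2] at hsum
  rw [sum_eq_card_nsmul hdZ, smul_eq_mul] at hle hsum
  omega

theorem FullyGraphic.card_mul_add_le {Y Z : Finset (Fin n)} (hYZ : Disjoint Y Z)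
    (hlow : #Y * c₁ + #Yᶜ * c₂ ≤ S) (hhigh : S ≤ #Z * c₂ + #Zᶜ * c₁) :
    #Y * c₁ + #Y * #Z + #Y ≤ #Y * n + #Z * c₂ := by
  obtain ⟨d, hd, hdY, hdZ⟩ :=
    exists_mem_simpleRegion_eqOn hc₂ hc hn (hD.2.2 ▸ hD.1.2) hYZ hlow hhigh
  simpa only [sum_eq_card_nsmul hdY, sum_eq_card_nsmul hdZ, smul_eq_mul] using
    hfull.sum_add_le hd hYZ

theorem SaturatedPair.sum_degree_ne {p q : Fin n} {G : SimpleGraph (Fin n)} [DecidableRel G.Adj]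
    {A X Y Z : Finset (Fin n)} (h : SaturatedPair G p q A X Y Z) (hA : c₂ ≤ #A)
    (hX : #X * c₂ + 2 ≤ ∑ x ∈ X, G.degree x) (hoff : ∀ v ∉ X, G.degree v ≤ c₁) :
    ∑ v, G.degree v ≠ S + 2 := by
  intro htotal
  by_cases hsmall : S ≤ #Y * c₁ + #Yᶜ * c₂
  · have hgraphic := hfull.add_card_le_sq_add hc₂ hc hn hD Y hsmall
    have hsat := h.sq_add_le_sum_degree hA hX
    omega
  by_cases hlarge : #Z * c₂ + #Zᶜ * c₁ ≤ S
  · have hgraphic := hfull.two_mul_add_card_le hc₂ hc hn hD Z hlarge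
    have hsat := h.sum_degree_add_sq_le (card_pos.1 (hc₂.trans_le hA)) hoff
    omega
  have hgraphic := hfull.card_mul_add_le hc₂ hc hn hD (disjoint_coe.1 h.disjoint)
    (not_le.1 hsmall).le (not_le.1 hlarge).le
  have hsat := h.card_mul_add_le_sum_degree_hub hA hX
  have hhub : ∑ y ∈ Y, G.degree y ≤ #Y * c₁ := sum_le_card_nsmul _ _ _ fun y hy =>
    hoff y fun hyX => Set.disjoint_left.1 h.disjoint hy (h.subset_rim hyX)
  rw [Fintype.card_fin] at hsat
  omega

end Bounds

end Region

section Perturb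

open Finset

variable {n S c₁ c₂ : ℕ} {D : Fin n → ℕ} {p q : Fin n}

theorem sum_perturb (D : Fin n → ℕ) {T : Finset (Fin n)} (hp : p ∈ T) (hq : q ∈ T) :
    ∑ i ∈ T, perturb D p q i = ∑ i ∈ T, D i + 2 := by
  simp [perturb, sum_add_distrib, sum_pi_single', hp, hq, add_assoc]

theorem perturb_of_ne {i : Fin n} (hp : i ≠ p) (hq : i ≠ q) : perturb D p q i = D i := by
  simp [perturb, hp, hq]

theorem lt_perturb_left : D p < perturb D p q p := by
  simp [perturb, add_assoc]

theorem Realizes.degree_eq {G : SimpleGraph (Fin n)} [DecidableRel G.Adj] {d : Fin n → ℕ}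
    (hG : Realizes G d) (i : Fin n) : G.degree i = d i := by
  convert hG i

theorem not_saturatedPair (hc₂ : 0 < c₂) (hc : c₂ ≤ c₁) (hn : c₁ < n)
    (hfull : FullyGraphic (simpleRegion n S c₁ c₂)) (hD : D ∈ simpleRegion n S c₁ c₂)
    {G : SimpleGraph (Fin n)} (hG : Realizes G (perturb D p q)) {A X Y Z : Finset (Fin n)} :
    ¬ SaturatedPair G p q A X Y Z := by
  classical
  intro h
  have hsum {T : Finset (Fin n)} (hp : p ∈ T) (hq : q ∈ T) :
      ∑ v ∈ T, G.degree v = ∑ v ∈ T, D v + 2 := by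
    simp only [hG.degree_eq, sum_perturb D hp hq]
  have htotal := hsum (mem_univ p) (mem_univ q)
  rw [hD.2.2] at htotal
  have hA : c₂ ≤ #A := by
    have hlt := (hG.degree_eq p).symm ▸ lt_perturb_left (D := D) (q := q)
    have hle := h.degree_left_le
    have := (hD.2.1 p).1
    omega
  have hX : #X * c₂ + 2 ≤ ∑ x ∈ X, G.degree x := by
    rw [hsum h.left_mem h.right_mem]
    gcongr
    exact card_nsmul_le_sum X D c₂ fun x _ => (hD.2.1 x).1
  have hoff : ∀ v ∉ X, G.degree v ≤ c₁ := fun v hv => by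
    rw [hG.degree_eq, perturb_of_ne (ne_of_mem_of_not_mem h.left_mem hv).symm
      (ne_of_mem_of_not_mem h.right_mem hv).symm]
    exact (hD.2.1 v).2
  exact h.sum_degree_ne hc₂ hc hn hfull hD hA hX hoff htotal

end Perturb

end DegSeq

theorem theorem2p3 (n S c₁ c₂ : ℕ) (hc₂ : 0 < c₂) (hc : c₂ ≤ c₁) (hn : c₁ < n)
    (hfull : DegSeq.FullyGraphic (DegSeq.simpleRegion n S c₁ c₂))
    (D : Fin n → ℕ) (hD : D ∈ DegSeq.simpleRegion n S c₁ c₂)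
    (p q : Fin n) (G : SimpleGraph (Fin n))
    (hG : DegSeq.Realizes G (DegSeq.perturb D p q))
    (hpq : G.neighborSet p = G.neighborSet q) :
    ∃ w : (⊤ : SimpleGraph (Fin n)).Walk p q, DegSeq.IsWitnessTrail G 11 w := by
  by_contra hno
  have htwins : DegSeq.UnlinkedTwins G p q := ⟨hpq, fun w hw => hno ⟨w, hw⟩⟩
  obtain ⟨A, X, Y, Z, h⟩ := htwins.exists_saturatedPair
  lift A to Finset (Fin n) using A.toFinite
  lift X to Finset (Fin n) using X.toFinite
  lift Y to Finset (Fin n) using Y.toFinite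
  lift Z to Finset (Fin n) using Z.toFinite
  exact DegSeq.not_saturatedPair hc₂ hc hn hfull hD hG h
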